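/- All rings are associative with unit, and modules are left modules unless stated otherwise. **Definitions.** A ring epimorphism is an epimorphism in the category of unital rings. Two ring epimorphisms $f:A\to B$ and $g:A\to C$ are equivalent ("$B$ and $C$ lie in the same epiclass of $A$") if there is a ring isomorphism $h:B\to C$ with $g=hf$. A ring epimorphism $f:A\to B$ is *homological* if $\mathrm{Tor}_i^A(B,B)=0$ for all $i>0$, and *1-finite* if $f$ turns $B$ into a finitely presented left $A$-module of projective dimension at most $1$. For a set $\Sigma$ of maps between finitely generated projective left $A$-modules, the universal localisation $f_\Sigma:A\to A_\Sigma$ is the ring homomorphism such that $A_\Sigma\otimes_A\sigma$ is an isomorphism for all $\sigma\in\Sigma$ and such that every ring homomorphism $g:A\to C$ for which $C\otimes_A\sigma$ is an isomorphism for all $\sigma\in\Sigma$ factors uniquely through $f_\Sigma$. For a finitely presented left $A$-module $U$ of projective dimension at most $1$, $A_{\{U\}}$ denotes $A_{\{\sigma_U\}}$, where $0\to P\xrightarrow{\sigma_U}Q\to U\to 0$ is any exact sequence with $P,Q$ finitely generated projective. **Statement.** Let $f:A\to B$ be a homological 1-finite ring epimorphism. 1. If $f$ is injective, then $\mathrm{coker}(f)=B/A$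 is a finitely presented left $A$-module of projective dimension at most $1$, and $B$ and $A_{\{B/A\}}$ lie in the same epiclass of $A$. 2. If $f$ is surjective, then $\ker(f)$ is a finitely presented projective left $A$-module, and $B$ and $A_{\{\ker(f)\}}$ lie in the same epiclass of $A$. 3. If $A$ is a finite dimensional algebra over a field $\mathbb{K}$ and $f$ is surjective, then there is an idempotent $e\in A$ such that $B$ and $A/AeA$ lie in the same epiclass of $A$. -/

import Mathlib

open CategoryTheory
open scoped TensorProduct

universe u v w

noncomputable section

namespace RingEpi

/-! ### Extension of scalars along a homomorphism of (non-commutative) rings -/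

section Extension

variable {A : Type u} {C : Type w} [Ring A] [Ring C] (f : A →+* C)

/-- The relations `c f(a) ⊗ m = c ⊗ a m` of the balanced tensor product `C ⊗_A M`. The set of
relators is stable under left multiplication by `C`, so that the `C`-submodule spanned by it is the
subgroup generated by it. -/
def balancedRel (M : Type v) [AddCommGroup M] [Module A M] : Submodule C (C ⊗[ℤ] M) :=
  Submodule.span C {x | ∃ (c : C) (a : A) (m : M), x = (c * f a) ⊗ₜ[ℤ] m - c ⊗ₜ[ℤ] (a • m)}

/-- The left `C`-module `C ⊗_A M`, where `C` is a right `A`-module through `f : A → C` and `M` is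
a left `A`-module. -/
abbrev ExtScalars (M : Type v) [AddCommGroup M] [Module A M] : Type (max w v) :=
  (C ⊗[ℤ] M) ⧸ balancedRel f M

variable {M N L : Type v} [AddCommGroup M] [Module A M] [AddCommGroup N] [Module A N]
  [AddCommGroup L] [Module A L]

/-- The element `c ⊗ m` of `C ⊗_A M`. -/
def ExtScalars.tmul (c : C) (m : M) : ExtScalars f M := Submodule.Quotient.mk (c ⊗ₜ[ℤ] m)

/-- The map `C ⊗_ℤ g : C ⊗_ℤ M → C ⊗_ℤ N` as a homomorphism of left `C`-modules. -/
def preMap (g : M →ₗ[A] N) : (C ⊗[ℤ] M) →ₗ[C] (C ⊗[ℤ] N) :=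
  TensorProduct.AlgebraTensorModule.map (LinearMap.id : C →ₗ[C] C) g.toAddMonoidHom.toIntLinearMap

theorem preMap_tmul (g : M →ₗ[A] N) (c : C) (m : M) :
    preMap g (c ⊗ₜ[ℤ] m) = c ⊗ₜ[ℤ] g m := rfl

theorem balancedRel_le (g : M →ₗ[A] N) :
    balancedRel f M ≤ (balancedRel f N).comap (preMap g) := by
  refine Submodule.span_le.2 ?_
  rintro _ ⟨c, a, m, rfl⟩
  refine Submodule.subset_span ⟨c, a, g m, ?_⟩
  rw [map_sub, preMap_tmul, preMap_tmul, map_smul]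

/-- The homomorphism `C ⊗_A g : C ⊗_A M → C ⊗_A N` of left `C`-modules. -/
def ExtScalars.map (g : M →ₗ[A] N) : ExtScalars f M →ₗ[C] ExtScalars f N :=
  (balancedRel f M).mapQ (balancedRel f N) (preMap g) (balancedRel_le f g)

theorem ExtScalars.map_tmul (g : M →ₗ[A] N) (c : C) (m : M) :
    ExtScalars.map f g (ExtScalars.tmul f c m) = ExtScalars.tmul f c (g m) := rfl

variable {f} in
theorem ExtScalars.hom_ext {X : Type*} [AddCommGroup X] [Module C X] {g h : ExtScalars f M →ₗ[C] X}
    (H : ∀ c m, g (ExtScalars.tmul f c m) = h (ExtScalars.tmul f c m)) : g = h := by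
  refine Submodule.linearMap_qext _ (LinearMap.toAddMonoidHom_injective ?_)
  ext x
  induction x using TensorProduct.induction_on with
  | zero => simp
  | tmul c m => exact H c m
  | add x y hx hy => rw [map_add, map_add, hx, hy]

theorem ExtScalars.tmul_add (c : C) (m n : M) :
    ExtScalars.tmul f c (m + n) = ExtScalars.tmul f c m + ExtScalars.tmul f c n :=
  congrArg Submodule.Quotient.mk (TensorProduct.tmul_add c m n)

end Extension

/-- The functor `C ⊗_A -` from left `A`-modules to left `C`-modules. -/
def extFunctor {A : Type u} {C : Type w} [Ring A] [Ring C] (f : A →+* C) :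
    ModuleCat.{v} A ⥤ ModuleCat.{max w v} C where
  obj M := ModuleCat.of C (ExtScalars f M)
  map g := ModuleCat.ofHom (ExtScalars.map f g.hom)
  map_id _ := ModuleCat.hom_ext (ExtScalars.hom_ext fun _ _ => rfl)
  map_comp _ _ := ModuleCat.hom_ext (ExtScalars.hom_ext fun _ _ => rfl)

instance {A : Type u} {C : Type w} [Ring A] [Ring C] (f : A →+* C) :
    (extFunctor.{u, v, w} f).Additive where
  map_add {_ _ g h} := ModuleCat.hom_ext (ExtScalars.hom_ext fun c m => ExtScalars.tmul_add f c (g.hom m) (h.hom m))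

section Epi

variable {A B C : Type u} [Ring A] [Ring B] [Ring C]

/-- `Tor_i^A(B, M)` for a ring homomorphism `f : A → B` and a left `A`-module `M`: the `i`-th left
derived functor of `B ⊗_A -`, applied to `M`. -/
def Tor (f : A →+* B) (i : ℕ) (M : ModuleCat.{u} A) : ModuleCat.{u} B :=
  ((extFunctor.{u, u, u} f).leftDerived i).obj M

/-- `B` as a left `A`-module through `f : A → B`. -/
def asModule (f : A →+* B) : ModuleCat.{u} A :=
  (ModuleCat.restrictScalars f).obj (ModuleCat.of B B)

/-- `f : A → B` as a homomorphism of left `A`-modules. -/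
def asLinearMap (f : A →+* B) : A →ₗ[A] asModule f where
  toFun a := (f a : B)
  map_add' := f.map_add
  map_smul' := f.map_mul

/-- The left `A`-module `coker f = B / f(A)`. -/
abbrev coker (f : A →+* B) : ModuleCat.{u} A :=
  ModuleCat.of A (asModule f ⧸ LinearMap.range (asLinearMap f))

/-- The left `A`-module `ker f`. -/
abbrev ker (f : A →+* B) : ModuleCat.{u} A := ModuleCat.of A (RingHom.ker f)

/-- Ring epimorphisms: epimorphisms in the category of rings with unit. -/
def IsRingEpi (f : A →+* B) : Prop := Epi (RingCat.ofHom f)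

/-- A ring epimorphism `f : A → B` is homological if `Tor_i^A(B, B) = 0` for all `i > 0`. -/
def IsHomological (f : A →+* B) : Prop :=
  IsRingEpi f ∧ ∀ i : ℕ, 0 < i → Limits.IsZero (Tor f i (asModule f))

/-- Finitely presented left modules of projective dimension at most one. -/
def IsFPOfProjDimLEOne (M : ModuleCat.{u} A) : Prop :=
  Module.FinitePresentation A M ∧ HasProjectiveDimensionLE M 1

/-- A ring epimorphism `f : A → B` is 1-finite if `B` is a finitely presented left `A`-module of
projective dimension at most one. -/
def IsOneFinite (f : A →+* B) : Prop :=
  IsRingEpi f ∧ IsFPOfProjDimLEOne (asModule f)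

/-- `f : A → B` and `g : A → C` are equivalent, i.e. `B` and `C` lie in the same epiclass of `A`:
both are ring epimorphisms and there is a ring isomorphism `h : B → C` with `g = h f`. -/
def SameEpiclass (f : A →+* B) (g : A →+* C) : Prop :=
  IsRingEpi f ∧ IsRingEpi g ∧ ∃ h : B ≃+* C, g = (h : B →+* C).comp f

end Epi

/-! ### Universal localisations -/

/-- A homomorphism between finitely generated projective left `A`-modules. -/
structure ProjMap (A : Type u) [Ring A] where
  P : ModuleCat.{u} A
  Q : ModuleCat.{u} A
  finite_P : Module.Finite A P
  finite_Q : Module.Finite A Q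
  projective_P : Module.Projective A P
  projective_Q : Module.Projective A Q
  hom : P →ₗ[A] Q

/-- `σ : P → Q` is a projective resolution of `U`: there is a short exact sequence
`0 → P → Q → U → 0` of left `A`-modules whose first map is `σ`. -/
def ProjMap.Resolves {A : Type u} [Ring A] (σ : ProjMap A) (U : ModuleCat.{u} A) : Prop :=
  Function.Injective σ.hom ∧
    ∃ p : σ.Q →ₗ[A] U, Function.Exact σ.hom p ∧ Function.Surjective p

/-- `f` inverts `Σ`: the map `C ⊗_A σ` is an isomorphism for all `σ ∈ Σ`. -/
def Inverts {A : Type u} {C : Type w} [Ring A] [Ring C] (f : A →+* C) (S : Set (ProjMap A)) :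
    Prop :=
  ∀ σ ∈ S, Function.Bijective (ExtScalars.map f σ.hom)

/-- `f : A → B` is the universal localisation of `A` at `Σ` (a set of maps between finitely
generated projective modules): `f` inverts `Σ`, and every ring homomorphism `g : A → C` that
inverts `Σ` factors in a unique way through `f`. The universe `w` of the test rings is arbitrary. -/
def IsUniversalLocalisation {A B : Type u} [Ring A] [Ring B] (f : A →+* B)
    (S : Set (ProjMap A)) : Prop :=
  Inverts f S ∧
    ∀ (C : Type w) [Ring C] (g : A →+* C), Inverts g S → ∃! h : B →+* C, g = h.comp f

/-- `f : A → B` is the universal localisation of `A` at a set `𝓤` of finitely presented left modules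
of projective dimension at most one: each `U ∈ 𝓤` has a projective resolution `σ_U : P → Q` with
`P`, `Q` finitely generated, and for each choice of such resolutions, `f` is the universal
localisation of `A` at `{σ_U | U ∈ 𝓤}`. -/
def IsUniversalLocalisationAt {A B : Type u} [Ring A] [Ring B] (f : A →+* B)
    (𝓤 : Set (ModuleCat.{u} A)) : Prop :=
  (∀ U ∈ 𝓤, IsFPOfProjDimLEOne U ∧ ∃ σ : ProjMap A, σ.Resolves U) ∧
    ∀ s : 𝓤 → ProjMap A, (∀ U : 𝓤, (s U).Resolves U) →
      IsUniversalLocalisation.{u, w} f (Set.range s)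

/-- `B` lies in the same epiclass of `A` as the universal localisation `A_𝓤`. -/
def SameEpiclassAsLocalisationAt {A B : Type u} [Ring A] [Ring B] (f : A →+* B)
    (𝓤 : Set (ModuleCat.{u} A)) : Prop :=
  ∃ (L : Type u) (_ : Ring L) (ι : A →+* L),
    IsUniversalLocalisationAt.{u, w} ι 𝓤 ∧ SameEpiclass f ι

/-- The canonical surjection `A → A / AeA`, where `AeA` is the two-sided ideal generated by `e`. -/
def modIdeal {A : Type u} [Ring A] (e : A) :
    A →+* (TwoSidedIdeal.span ({e} : Set A)).ringCon.Quotient :=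
  (TwoSidedIdeal.span ({e} : Set A)).ringCon.mk'

end RingEpi

end

/-! Homologicality enters through Tor₁(B, B) = 0. It makes a two-term projective resolution of B
injective after B ⊗ - (`map_injective_of_isZero_tor`). Right exactness gives the rest: C ⊗ σ is
surjective iff C ⊗ coker σ = 0 (`ExtScalars.map_surjective_iff_subsingleton`). In both localisation
statements f itself is shown to be the universal localisation.

Injective case: a resolution σ of B/A lifts to one of B with middle term Q ⊕ A. As B ⊗ f is
bijective, f inverts σ. If g : A → C inverts σ, the lifted resolution extends g to a semilinear map
B → C. It is multiplicative because C ⊗ B/A = 0.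

Surjective case: I = ker f is projective by dimension shifting, and B ⊗ I → B ⊗ A is both injective
and zero, so B ⊗ I = 0. A map g with C ⊗ I = 0 kills I, hence factors through f.

Finite dimensional case: projectivity of I and B ⊗ I = 0 give I = I². Take e ∈ I idempotent and
maximal. Elements of (1-e)I(1-e) are nilpotent, and a Nakayama argument then gives I = AeA. -/

noncomputable section

namespace RingEpi

/-! ### Calculus and right exactness of extension of scalars -/

section ExtScalars

variable {A : Type u} {C : Type w} [Ring A] [Ring C] {f : A →+* C}
variable {M N L : Type v} [AddCommGroup M] [Module A M] [AddCommGroup N] [Module A N]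
  [AddCommGroup L] [Module A L]

theorem ExtScalars.tmul_smul (c : C) (a : A) (m : M) :
    ExtScalars.tmul f c (a • m) = ExtScalars.tmul f (c * f a) m :=
  Eq.symm <| (Submodule.Quotient.eq (balancedRel f M)).2
    (Submodule.subset_span ⟨c, a, m, rfl⟩)

theorem ExtScalars.smul_tmul (c d : C) (m : M) :
    c • ExtScalars.tmul f d m = ExtScalars.tmul f (c * d) m := rfl

theorem ExtScalars.tmul_zero (c : C) : ExtScalars.tmul f c (0 : M) = 0 :=
  congrArg Submodule.Quotient.mk (TensorProduct.tmul_zero M c)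

theorem ExtScalars.zero_tmul (m : M) : ExtScalars.tmul f 0 m = 0 :=
  congrArg Submodule.Quotient.mk (TensorProduct.zero_tmul C m)

theorem ExtScalars.add_tmul (c d : C) (m : M) :
    ExtScalars.tmul f (c + d) m = ExtScalars.tmul f c m + ExtScalars.tmul f d m :=
  congrArg Submodule.Quotient.mk (TensorProduct.add_tmul c d m)

theorem ExtScalars.induction {p : ExtScalars f M → Prop} (z : ExtScalars f M) (zero : p 0)
    (tmul : ∀ c m, p (ExtScalars.tmul f c m)) (add : ∀ x y, p x → p y → p (x + y)) : p z := by
  obtain ⟨t, rfl⟩ := Submodule.Quotient.mk_surjective _ z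
  induction t using TensorProduct.induction_on with
  | zero => exact zero
  | tmul c m => exact tmul c m
  | add x y hx hy => exact add _ _ hx hy

theorem ExtScalars.map_comp_apply (h : N →ₗ[A] L) (g : M →ₗ[A] N) (z : ExtScalars f M) :
    ExtScalars.map f h (ExtScalars.map f g z) = ExtScalars.map f (h ∘ₗ g) z :=
  LinearMap.congr_fun (ExtScalars.hom_ext (f := f)
    (g := ExtScalars.map f h ∘ₗ ExtScalars.map f g) (h := ExtScalars.map f (h ∘ₗ g))
    fun _ _ => rfl) z

theorem ExtScalars.map_zero_apply (z : ExtScalars f M) :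
    ExtScalars.map f (0 : M →ₗ[A] N) z = 0 :=
  LinearMap.congr_fun (ExtScalars.hom_ext (f := f) (h := 0)
    fun c m => (ExtScalars.map_tmul f 0 c m).trans (ExtScalars.tmul_zero c)) z

theorem ExtScalars.map_id_apply (z : ExtScalars f M) :
    ExtScalars.map f (LinearMap.id : M →ₗ[A] M) z = z :=
  LinearMap.congr_fun (ExtScalars.hom_ext (f := f)
    (g := ExtScalars.map f (LinearMap.id : M →ₗ[A] M)) (h := LinearMap.id) fun _ _ => rfl) z

theorem ExtScalars.map_add_apply (g h : M →ₗ[A] N) (z : ExtScalars f M) :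
    ExtScalars.map f (g + h) z = ExtScalars.map f g z + ExtScalars.map f h z :=
  LinearMap.congr_fun (ExtScalars.hom_ext (f := f)
    (h := ExtScalars.map f g + ExtScalars.map f h)
    fun c m => ExtScalars.tmul_add f c (g m) (h m)) z

/-- The universal property of `C ⊗_A M`: a semilinear map from `M` to a `C`-module `X` extends to a
`C`-linear map `C ⊗_A M → X`. -/
def ExtScalars.lift {X : Type*} [AddCommGroup X] [Module C X] (φ : M →ₛₗ[f] X) :
    ExtScalars f M →ₗ[C] X :=
  (balancedRel f M).liftQ
    (TensorProduct.AlgebraTensorModule.lift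
      (LinearMap.toSpanSingleton C (M →ₗ[ℤ] X) φ.toAddMonoidHom.toIntLinearMap)) <| by
    refine Submodule.span_le.2 ?_
    rintro _ ⟨c, a, m, rfl⟩
    simp [mul_smul]

theorem ExtScalars.lift_tmul {X : Type*} [AddCommGroup X] [Module C X] (φ : M →ₛₗ[f] X)
    (c : C) (m : M) : ExtScalars.lift φ (ExtScalars.tmul f c m) = c • φ m := rfl

variable (f) in
theorem ExtScalars.map_surjective {g : M →ₗ[A] N} (hg : Function.Surjective g) :
    Function.Surjective (ExtScalars.map f g) := by
  intro z
  induction z using ExtScalars.induction with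
  | zero => exact ⟨0, map_zero _⟩
  | tmul c m =>
    obtain ⟨x, rfl⟩ := hg m
    exact ⟨ExtScalars.tmul f c x, rfl⟩
  | add x y hx hy =>
    obtain ⟨x, rfl⟩ := hx
    obtain ⟨y, rfl⟩ := hy
    exact ⟨x + y, map_add _ _ _⟩

/-- A semilinear map that vanishes on the kernel of a surjective linear map factors through it. -/
theorem exists_semilinear_factor {X : Type*} [AddCommGroup X] [Module C X] {p : M →ₗ[A] N}
    (hp : Function.Surjective p) (ψ : M →ₛₗ[f] X) (h : ∀ x, p x = 0 → ψ x = 0) :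
    ∃ φ : N →ₛₗ[f] X, ∀ x, φ (p x) = ψ x := by
  refine ⟨(p.ker.liftQ ψ fun x hx => h x hx).comp
    (p.quotKerEquivOfSurjective hp).symm.toLinearMap, fun x => ?_⟩
  have : (p.quotKerEquivOfSurjective hp).symm (p x) = Submodule.Quotient.mk x := by
    rw [LinearEquiv.symm_apply_eq]; rfl
  exact congrArg (p.ker.liftQ ψ fun x hx => h x hx) this

variable (f) in
/-- `C ⊗_A σ` is surjective if and only if `C ⊗_A coker σ` vanishes. -/
theorem ExtScalars.map_surjective_iff_subsingleton {σ : M →ₗ[A] N} {p : N →ₗ[A] L}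
    (he : Function.Exact σ p) (hp : Function.Surjective p) :
    Function.Surjective (ExtScalars.map f σ) ↔ Subsingleton (ExtScalars f L) := by
  constructor
  · intro hs
    refine subsingleton_of_forall_eq 0 fun z => ?_
    obtain ⟨y, rfl⟩ := ExtScalars.map_surjective f hp z
    obtain ⟨x, rfl⟩ := hs y
    rw [ExtScalars.map_comp_apply, he.linearMap_comp_eq_zero, ExtScalars.map_zero_apply]
  · intro hL
    -- The map x ↦ 1 ⊗ x into the cokernel of C ⊗ σ kills σ(M), so it factors through L. Hence the
    -- projection onto that cokernel factors through C ⊗ L = 0.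
    let R := LinearMap.range (ExtScalars.map f σ)
    let ψ : N →ₛₗ[f] (ExtScalars f N ⧸ R) :=
      { toFun := fun x => R.mkQ (ExtScalars.tmul f 1 x)
        map_add' := fun x y => by rw [ExtScalars.tmul_add, map_add]
        map_smul' := fun a x => by
          rw [ExtScalars.tmul_smul, one_mul, ← map_smul, ExtScalars.smul_tmul, mul_one] }
    obtain ⟨φ, hφ⟩ := exists_semilinear_factor hp ψ fun x hx => by
      obtain ⟨y, rfl⟩ := (he x).1 hx
      exact (Submodule.Quotient.mk_eq_zero _).2 ⟨ExtScalars.tmul f 1 y, rfl⟩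
    have key : ExtScalars.lift φ ∘ₗ ExtScalars.map f p = R.mkQ := by
      refine ExtScalars.hom_ext fun c m => ?_
      rw [LinearMap.comp_apply, ExtScalars.map_tmul, ExtScalars.lift_tmul, hφ]
      change c • R.mkQ (ExtScalars.tmul f 1 m) = _
      rw [← map_smul, ExtScalars.smul_tmul, mul_one]
    rw [← LinearMap.range_eq_top, eq_top_iff]
    intro z _
    change z ∈ R
    rw [← Submodule.ker_mkQ R, ← key]
    rw [LinearMap.mem_ker, LinearMap.comp_apply, Subsingleton.elim (ExtScalars.map f p z) 0,
      map_zero]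

end ExtScalars

/-! ### Ring epimorphisms and B ⊗ B ≅ B -/

section Epimorphisms

variable {A B : Type u} [Ring A] [Ring B] {f : A →+* B}

theorem isRingEpi_of_surjective (hf : Function.Surjective f) : IsRingEpi f :=
  ConcreteCategory.epi_of_surjective (RingCat.ofHom f) hf

/-- Left multiplication of `B` on `B ⊕ M`, conjugated by the shear of an additive map
`φ : B → M`. -/
def shearedLeftMul {M : Type u} [AddCommGroup M] [Module B M] (φ : B →+ M) :
    B →+* AddMonoid.End (B × M) where
  toFun b :=
    { toFun := fun x => (b * x.1, b • (x.2 - φ x.1) + φ (b * x.1))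
      map_zero' := by simp
      map_add' := fun x y => by
        refine Prod.ext (mul_add _ _ _) ?_
        simp only [Prod.snd_add, Prod.fst_add, map_add, mul_add, smul_add, smul_sub]
        abel }
  map_one' := AddMonoidHom.ext fun x => Prod.ext (one_mul _) <| by
    change (1 : B) • (x.2 - φ x.1) + φ (1 * x.1) = x.2
    rw [one_smul, one_mul, sub_add_cancel]
  map_mul' b c := AddMonoidHom.ext fun x => Prod.ext (mul_assoc _ _ _) <| by
    change (b * c) • (x.2 - φ x.1) + φ (b * c * x.1) =
      b • (c • (x.2 - φ x.1) + φ (c * x.1) - φ (c * x.1)) + φ (b * (c * x.1))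
    rw [add_sub_cancel_right, mul_smul, mul_assoc]
  map_zero' := AddMonoidHom.ext fun x => Prod.ext (zero_mul _) <| by
    change (0 : B) • (x.2 - φ x.1) + φ (0 * x.1) = 0
    rw [zero_smul, zero_mul, map_zero, add_zero]
  map_add' b c := AddMonoidHom.ext fun x => Prod.ext (add_mul _ _ _) <| by
    change (b + c) • (x.2 - φ x.1) + φ ((b + c) * x.1) =
      b • (x.2 - φ x.1) + φ (b * x.1) + (c • (x.2 - φ x.1) + φ (c * x.1))
    rw [add_smul, add_mul, map_add]
    abel

variable (f) in
/-- The element of the left `A`-module `asModule f` given by an element of `B`. -/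
def toAsModule : B →+ asModule f := AddMonoidHom.id B

theorem toAsModule_surjective : Function.Surjective (toAsModule f) := Function.surjective_id

theorem smul_toAsModule (a : A) (b : B) : a • toAsModule f b = toAsModule f (f a * b) := rfl

theorem asLinearMap_apply (a : A) : asLinearMap f a = toAsModule f (f a) := rfl

/-- If `f : A → B` is a ring epimorphism, then `b ⊗ x = 1 ⊗ b x` in `B ⊗_A B`. -/
theorem IsRingEpi.tmul_eq (hf : IsRingEpi f) (b x : B) :
    ExtScalars.tmul f b (toAsModule f x) = ExtScalars.tmul f 1 (toAsModule f (b * x)) := by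
  let φ : B →+ ExtScalars f (asModule f) :=
    { toFun := fun y => ExtScalars.tmul f 1 (toAsModule f y)
      map_zero' := by rw [map_zero, ExtScalars.tmul_zero]
      map_add' := fun y z => by rw [map_add, ExtScalars.tmul_add] }
  have hφ : ∀ y, φ y = ExtScalars.tmul f 1 (toAsModule f y) := fun _ => rfl
  -- The sheared and the plain left multiplication agree on f(A) because φ is A-linear. Being epi
  -- makes them agree on B, and evaluation at (x, 0) says that φ is B-linear.
  have h : RingCat.ofHom f ≫ RingCat.ofHom (shearedLeftMul φ) =
      RingCat.ofHom f ≫ RingCat.ofHom (shearedLeftMul 0) := by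
    refine RingCat.hom_ext (RingHom.ext fun a => AddMonoidHom.ext fun y => Prod.ext rfl ?_)
    change f a • (y.2 - φ y.1) + φ (f a * y.1) = f a • (y.2 - 0) + 0
    rw [hφ (f a * y.1), ← smul_toAsModule, ExtScalars.tmul_smul, smul_sub, hφ,
      ExtScalars.smul_tmul, one_mul, mul_one, sub_add_cancel, sub_zero, add_zero]
  have hf' : Epi (RingCat.ofHom f) := hf
  have h' : b • (0 - φ x) + φ (b * x) = b • (0 - 0) + 0 :=
    congrArg Prod.snd (DFunLike.congr_fun (DFunLike.congr_fun
      (congrArg RingCat.Hom.hom ((cancel_epi _).1 h)) b) ((x, 0) : B × ExtScalars f (asModule f)))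
  rw [zero_sub, smul_neg, sub_zero, smul_zero, add_zero, neg_add_eq_zero, hφ, hφ,
    ExtScalars.smul_tmul, mul_one] at h'
  exact h'

/-- If `f : A → B` is a ring epimorphism, then `B ≅ B ⊗_A A → B ⊗_A B` is bijective. -/
theorem IsRingEpi.map_asLinearMap_bijective (hf : IsRingEpi f) :
    Function.Bijective (ExtScalars.map f (asLinearMap f)) := by
  -- Multiplication B ⊗ B → B, followed by b ↦ b ⊗ 1, is a retraction of B ⊗ f.
  let μ : asModule f →ₛₗ[f] B :=
    { toFun := fun b => b, map_add' := fun _ _ => rfl, map_smul' := fun _ _ => rfl }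
  have key : ∀ z : ExtScalars f A, ExtScalars.tmul f
      (ExtScalars.lift μ (ExtScalars.map f (asLinearMap f) z)) 1 = z := by
    intro z
    induction z using ExtScalars.induction with
    | zero => rw [map_zero, map_zero, ExtScalars.zero_tmul]
    | tmul c a =>
      rw [ExtScalars.map_tmul, ExtScalars.lift_tmul]
      change ExtScalars.tmul f (c * f a) 1 = _
      rw [← ExtScalars.tmul_smul, smul_eq_mul, mul_one]
    | add x y hx hy => rw [map_add, map_add, ExtScalars.add_tmul, hx, hy]
  refine ⟨fun x y h => by rw [← key x, ← key y, h], fun z => ?_⟩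
  induction z using ExtScalars.induction with
  | zero => exact ⟨0, map_zero _⟩
  | tmul c b =>
    obtain ⟨b, rfl⟩ := toAsModule_surjective b
    refine ⟨ExtScalars.tmul f (c * b) 1, ?_⟩
    rw [ExtScalars.map_tmul, asLinearMap_apply, map_one, hf.tmul_eq, mul_one, ← hf.tmul_eq]
  | add x y hx hy =>
    obtain ⟨x, rfl⟩ := hx
    obtain ⟨y, rfl⟩ := hy
    exact ⟨x + y, map_add _ _ _⟩

/-- A ring epimorphism in universe `u` is right cancellable for test rings in all universes. -/
theorem IsRingEpi.ringHom_ext (hf : IsRingEpi f) {C : Type w} [Ring C] {g h : B →+* C}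
    (H : g.comp f = h.comp f) : g = h := by
  -- With B acting on C through g, the map h is semilinear along f. Applying its extension to b ⊗ 1
  -- = 1 ⊗ b compares g b with h b.
  let _ : Module B C := Module.compHom C g
  let φ : asModule f →ₛₗ[f] C :=
    { toFun := h
      map_add' := h.map_add
      map_smul' := fun a b => by
        have ha : g (f a) = h (f a) := RingHom.congr_fun H a
        exact (h.map_mul (f a) b).trans (congrArg (fun c : C => c * h b) ha.symm) }
  ext b
  have := congrArg (ExtScalars.lift φ) (hf.tmul_eq b 1)
  rw [ExtScalars.lift_tmul, ExtScalars.lift_tmul, mul_one] at this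
  change g b * h 1 = g 1 * h b at this
  simpa using this

end Epimorphisms

end RingEpi

end

noncomputable section

namespace RingEpi

/-! ### Two-term resolutions and Tor₁ -/

section TwoTermResolution

variable {A : Type u} [Ring A] {P Q U : ModuleCat.{u} A}

/-- The objects of the chain complex `⋯ → 0 → P → Q`. -/
def twoTermX (P Q : ModuleCat.{u} A) : ℕ → ModuleCat.{u} A
  | 0 => Q
  | 1 => P
  | _ + 2 => ModuleCat.of A PUnit

/-- The differentials of the chain complex `⋯ → 0 → P → Q`. -/
def twoTermD (σ : P ⟶ Q) : ∀ n, twoTermX P Q (n + 1) ⟶ twoTermX P Q n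
  | 0 => σ
  | _ + 1 => 0

/-- The chain complex `⋯ → 0 → P → Q`, with `Q` in degree `0`. -/
def twoTerm (σ : P ⟶ Q) : ChainComplex (ModuleCat.{u} A) ℕ :=
  ChainComplex.of (twoTermX P Q) (twoTermD σ) fun _ => Limits.zero_comp

theorem twoTerm_d_one_zero (σ : P ⟶ Q) : (twoTerm σ).d 1 0 = σ :=
  ChainComplex.of_d (twoTermX P Q) (twoTermD σ) 0

theorem isZero_twoTerm_X (σ : P ⟶ Q) (n : ℕ) : Limits.IsZero ((twoTerm σ).X (n + 2)) :=
  ModuleCat.isZero_of_subsingleton (ModuleCat.of A PUnit)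

theorem twoTerm_exactAt_succ {σ : P ⟶ Q} (hσ : Mono σ) (n : ℕ) :
    (twoTerm σ).ExactAt (n + 1) := by
  rw [HomologicalComplex.exactAt_iff' _ (n + 2) (n + 1) n (by simp) (by simp)]
  cases n with
  | zero =>
    refine (ShortComplex.exact_iff_mono _ ((isZero_twoTerm_X σ 0).eq_of_src _ _)).2 ?_
    change Mono ((twoTerm σ).d 1 0)
    rw [twoTerm_d_one_zero]
    exact hσ
  | succ n => exact ShortComplex.exact_of_isZero_X₂ _ (isZero_twoTerm_X σ n)

/-- The projective resolution given by a short exact sequence `0 → P → Q → U → 0`. -/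
def twoTermResolution (σ : P ⟶ Q) (p : Q ⟶ U) (hP : Projective P) (hQ : Projective Q)
    (w : σ ≫ p = 0) (hS : (ShortComplex.mk σ p w).ShortExact) : ProjectiveResolution U where
  complex := twoTerm σ
  projective n := by
    match n with
    | 0 => exact hQ
    | 1 => exact hP
    | n + 2 => exact (isZero_twoTerm_X σ n).projective
  π := (ChainComplex.toSingle₀Equiv (twoTerm σ) U).symm
    ⟨p, by rw [twoTerm_d_one_zero]; exact w⟩
  quasiIso := ⟨fun n => by
    cases n with
    | zero =>
      -- In degree 0 a quasi-isomorphism amounts to exactness of P → Q → U at Q together with p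
      -- being epi.
      rw [ChainComplex.quasiIsoAt₀_iff, ShortComplex.quasiIso_iff_of_zeros']
      · refine (ShortComplex.exact_and_epi_g_iff_of_iso ?_).2 ⟨hS.exact, hS.epi_g⟩
        exact ShortComplex.isoMk (Iso.refl _) (Iso.refl _) (Iso.refl _)
          ((Category.id_comp _).trans ((twoTerm_d_one_zero σ).symm.trans
            (Category.comp_id _).symm))
          ((Category.id_comp _).trans (Eq.symm ((Category.comp_id _).trans
            (ChainComplex.toSingle₀Equiv_symm_apply_f_zero (C := twoTerm σ) p _))))
      all_goals rfl
    | succ n =>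
      rw [quasiIsoAt_iff_exactAt']
      · exact twoTerm_exactAt_succ hS.mono_f n
      · apply ChainComplex.exactAt_succ_single_obj⟩

end TwoTermResolution

theorem shortExact_ofHom {A : Type u} [Ring A] {U : ModuleCat.{u} A} {P Q : Type u}
    [AddCommGroup P] [Module A P] [AddCommGroup Q] [Module A Q] {σ : P →ₗ[A] Q} {p : Q →ₗ[A] U}
    (hσ : Function.Injective σ) (he : Function.Exact σ p) (hp : Function.Surjective p) :
    (ShortComplex.mk (X₁ := ModuleCat.of A P) (X₂ := ModuleCat.of A Q) (X₃ := U)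
      (ModuleCat.ofHom σ) (ModuleCat.ofHom p)
      (ModuleCat.hom_ext he.linearMap_comp_eq_zero)).ShortExact :=
  { exact := (ShortComplex.ShortExact.moduleCat_exact_iff_function_exact _).2 he
    mono_f := (ModuleCat.mono_iff_injective _).2 hσ
    epi_g := (ModuleCat.epi_iff_surjective _).2 hp }

/-- If `Tor₁(B, U)` vanishes and `0 → P → Q → U → 0` is exact with `P` and `Q` projective, then
`B ⊗_A P → B ⊗_A Q` is injective. -/
theorem map_injective_of_isZero_tor {A B : Type u} [Ring A] [Ring B] {f : A →+* B}
    {U : ModuleCat.{u} A} (hU : Limits.IsZero (Tor f 1 U)) {P Q : Type u} [AddCommGroup P]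
    [Module A P] [AddCommGroup Q] [Module A Q] [Module.Projective A P] [Module.Projective A Q]
    {σ : P →ₗ[A] Q} {p : Q →ₗ[A] U} (hσ : Function.Injective σ) (he : Function.Exact σ p)
    (hp : Function.Surjective p) : Function.Injective (ExtScalars.map f σ) := by
  let R := twoTermResolution _ _ ((IsProjective.iff_projective _).1 inferInstance)
    ((IsProjective.iff_projective _).1 inferInstance) _
    (shortExact_ofHom hσ he hp)
  let F := extFunctor.{u, u, u} f
  have h1 := hU.of_iso (R.isoLeftDerivedObj F 1).symm
  have h2 : ((F.mapHomologicalComplex _).obj (twoTerm (ModuleCat.ofHom σ))).ExactAt 1 :=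
    (HomologicalComplex.exactAt_iff_isZero_homology _ _).2 h1
  rw [HomologicalComplex.exactAt_iff' _ 2 1 0 (by simp) (by simp)] at h2
  -- The term in degree 2 is zero, so exactness in degree 1 means that the differential is mono.
  have h3 := (ShortComplex.exact_iff_mono _
    ((F.map_isZero (isZero_twoTerm_X (ModuleCat.ofHom σ) 0)).eq_of_src _ _)).1 h2
  change Mono (F.map ((twoTerm (ModuleCat.ofHom σ)).d 1 0)) at h3
  rw [twoTerm_d_one_zero] at h3
  exact (ModuleCat.mono_iff_injective _).1 h3

end RingEpi

end

noncomputable section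

namespace RingEpi

/-! ### Syzygies and existence of resolutions -/

section ProjectiveDimension

variable {A : Type u} [Ring A]

/-- The first syzygy of a module of projective dimension at most one is projective. -/
theorem projective_of_shortExact {U : ModuleCat.{u} A} (hU : HasProjectiveDimensionLE U 1)
    {P Q : Type u} [AddCommGroup P] [Module A P] [AddCommGroup Q] [Module A Q]
    [Module.Projective A Q] {σ : P →ₗ[A] Q} {p : Q →ₗ[A] U} (hσ : Function.Injective σ)
    (he : Function.Exact σ p) (hp : Function.Surjective p) : Module.Projective A P := by
  have hQ : Projective (ModuleCat.of A Q) := (IsProjective.iff_projective Q).1 inferInstance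
  have := ((shortExact_ofHom hσ he hp).hasProjectiveDimensionLT_X₃_iff 0 hQ).1 hU
  exact (IsProjective.iff_projective P).2 (projective_iff_hasProjectiveDimensionLT_one.2 this)

theorem isFPOfProjDimLEOne_of_projective (U : ModuleCat.{u} A) [Module.Finite A U]
    [Module.Projective A U] : IsFPOfProjDimLEOne U := by
  refine ⟨Module.finitePresentation_of_projective A U, ?_⟩
  have hU : Projective (ModuleCat.of A U) := (IsProjective.iff_projective U).1 inferInstance
  have : HasProjectiveDimensionLT U 1 := projective_iff_hasProjectiveDimensionLT_one.1 hU
  exact hasProjectiveDimensionLT_of_ge U 1 2 (by norm_num)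

theorem IsFPOfProjDimLEOne.exists_resolves {U : ModuleCat.{u} A} (hU : IsFPOfProjDimLEOne U) :
    ∃ σ : ProjMap A, σ.Resolves U := by
  obtain ⟨hfp, hpd⟩ := hU
  obtain ⟨n, _, p, -, hp, -⟩ := Module.FinitePresentation.exists_fin' A U
  have hker : Function.Exact p.ker.subtype p := LinearMap.exact_subtype_ker_map p
  exact ⟨{  P := ModuleCat.of A p.ker
            Q := ModuleCat.of A (Fin n → A)
            finite_P := Module.Finite.iff_fg.2 (Module.FinitePresentation.fg_ker p hp)
            finite_Q := inferInstanceAs (Module.Finite A (Fin n → A))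
            projective_P := projective_of_shortExact hpd p.ker.injective_subtype hker hp
            projective_Q := inferInstanceAs (Module.Projective A (Fin n → A))
            hom := p.ker.subtype }, p.ker.injective_subtype, p, hker, hp⟩

end ProjectiveDimension

variable {A B : Type u} [Ring A] [Ring B] {f : A →+* B}

/-- Takes B itself as the localisation, so that no separate construction of A_{U} is required. -/
theorem SameEpiclassAsLocalisationAt.of_isUniversalLocalisation (hf : IsRingEpi f)
    {U : ModuleCat.{u} A} (hU : IsFPOfProjDimLEOne U)
    (h : ∀ σ : ProjMap A, σ.Resolves U → IsUniversalLocalisation.{u, w} f {σ}) :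
    SameEpiclassAsLocalisationAt.{u, w} f {U} := by
  refine ⟨B, inferInstance, f, ⟨?_, fun s hs => ?_⟩, hf, hf, RingEquiv.refl B, rfl⟩
  · rintro _ rfl
    exact ⟨hU, hU.exists_resolves⟩
  · rw [Set.range_unique]
    exact h _ (hs _)

theorem exact_asLinearMap_mkQ :
    Function.Exact (asLinearMap f) (LinearMap.range (asLinearMap f)).mkQ :=
  LinearMap.exact_map_mkQ_range _

/-! ### Injective epimorphisms: localisation at B/A -/

section Injective

theorem isFPOfProjDimLEOne_coker (hB : IsFPOfProjDimLEOne (asModule f))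
    (hinj : Function.Injective f) : IsFPOfProjDimLEOne (coker f) := by
  obtain ⟨hfp, hpd⟩ := hB
  constructor
  · refine Module.finitePresentation_of_surjective (LinearMap.range (asLinearMap f)).mkQ
      (Submodule.mkQ_surjective _) ?_
    rw [Submodule.ker_mkQ]
    exact Submodule.fg_range _
  · have hA : Projective (ModuleCat.of A A) := (IsProjective.iff_projective A).1 inferInstance
    have h1 : HasProjectiveDimensionLT (ModuleCat.of A A) 1 :=
      projective_iff_hasProjectiveDimensionLT_one.1 hA
    exact (shortExact_ofHom (U := coker f) (P := A) (Q := asModule f) (σ := asLinearMap f) hinj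
      exact_asLinearMap_mkQ (Submodule.mkQ_surjective _)).hasProjectiveDimensionLT_X₃ 1 h1 hpd

/-- A projective resolution `0 → P → Q → B / A → 0` lifts to a projective resolution
`0 → P → Q ⊕ A → B → 0`. -/
theorem exists_resolution_of_coker (hinj : Function.Injective f) {σ : ProjMap A}
    (hσ : σ.Resolves (coker f)) :
    ∃ (q : σ.Q →ₗ[A] asModule f) (α : σ.P →ₗ[A] A),
      q ∘ₗ σ.hom = asLinearMap f ∘ₗ α ∧ Function.Injective (σ.hom.prod α) ∧
      Function.Exact (σ.hom.prod α) (q.coprod (-asLinearMap f)) ∧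
      Function.Surjective (q.coprod (-asLinearMap f)) := by
  obtain ⟨hi, p, he, hp⟩ := hσ
  have := σ.projective_Q
  obtain ⟨q, hq⟩ := Module.projective_lifting_property (LinearMap.range (asLinearMap f)).mkQ p
    (Submodule.mkQ_surjective _)
  have hq' : ∀ x, p x = 0 ↔ q x ∈ LinearMap.range (asLinearMap f) := fun x => by
    rw [← hq, LinearMap.comp_apply, Submodule.mkQ_apply, Submodule.Quotient.mk_eq_zero]
  have hinj' : Function.Injective (asLinearMap f) := hinj
  let e := LinearEquiv.ofInjective (asLinearMap f) hinj'
  -- Since p σ = 0, the lift q of p sends σ(P) into f(A), which is identified with A by injectivity.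
  let α : σ.P →ₗ[A] A := e.symm.toLinearMap ∘ₗ
    (q ∘ₗ σ.hom).codRestrict _ fun y => (hq' _).1 (he.apply_apply_eq_zero y)
  have hα : ∀ y, asLinearMap f (α y) = q (σ.hom y) := fun y =>
    congrArg Subtype.val (e.apply_symm_apply ⟨q (σ.hom y), _⟩)
  refine ⟨q, α, LinearMap.ext fun y => (hα y).symm, fun y z h => hi (congrArg Prod.fst h),
    fun x => ⟨fun hx => ?_, ?_⟩, fun b => ?_⟩
  · have hx' : q x.1 = asLinearMap f x.2 := by
      simpa [add_neg_eq_zero] using hx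
    obtain ⟨y, hy⟩ := (he x.1).1 ((hq' _).2 ⟨x.2, hx'.symm⟩)
    exact ⟨y, Prod.ext hy (hinj' ((hα y).trans ((congrArg q hy).trans hx')))⟩
  · rintro ⟨y, rfl⟩
    simp [hα]
  · obtain ⟨x, hx⟩ := hp (Submodule.Quotient.mk b)
    rw [← hq] at hx
    obtain ⟨a, ha⟩ := (Submodule.Quotient.eq _).1 hx
    exact ⟨(x, a), by simp [ha]⟩

/-- Both maps σ and f have cokernel B/A, so both conditions say C ⊗ B/A = 0. -/
theorem map_resolution_coker_surjective_iff {C : Type w} [Ring C] (g : A →+* C) {σ : ProjMap A}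
    (hσ : σ.Resolves (coker f)) :
    Function.Surjective (ExtScalars.map g σ.hom) ↔
      Function.Surjective (ExtScalars.map g (asLinearMap f)) := by
  obtain ⟨-, p, he, hp⟩ := hσ
  rw [ExtScalars.map_surjective_iff_subsingleton g he hp,
    ExtScalars.map_surjective_iff_subsingleton g (exact_asLinearMap_mkQ (f := f))
      (Submodule.mkQ_surjective _)]

/-- If B ⊗ σ kills z, then q σ = f α and injectivity of B ⊗ f show that B ⊗ α kills z too. But B ⊗
(σ, α) is injective by Tor₁(B, B) = 0. -/
theorem inverts_resolution_coker (hf : IsRingEpi f) (hTor : Limits.IsZero (Tor f 1 (asModule f)))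
    (hinj : Function.Injective f) {σ : ProjMap A} (hσ : σ.Resolves (coker f)) :
    Function.Bijective (ExtScalars.map f σ.hom) := by
  refine ⟨?_, (map_resolution_coker_surjective_iff f hσ).2 hf.map_asLinearMap_bijective.2⟩
  obtain ⟨q, α, hq, hi, he, hs⟩ := exists_resolution_of_coker hinj hσ
  have := σ.projective_P
  have := σ.projective_Q
  have hτ := map_injective_of_isZero_tor hTor hi he hs
  rw [injective_iff_map_eq_zero] at hτ ⊢
  intro z hz
  have hαz : ExtScalars.map f α z = 0 := by
    apply hf.map_asLinearMap_bijective.1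
    rw [ExtScalars.map_comp_apply, ← hq, ← ExtScalars.map_comp_apply, hz, map_zero, map_zero]
  apply hτ
  have hsum : σ.hom.prod α = LinearMap.inl A σ.Q A ∘ₗ σ.hom + LinearMap.inr A σ.Q A ∘ₗ α := by
    ext x <;> simp
  rw [hsum, ExtScalars.map_add_apply, ← ExtScalars.map_comp_apply, ← ExtScalars.map_comp_apply,
    hz, hαz, map_zero, map_zero, add_zero]

/-- If `g : A → C` inverts a projective resolution of `B / A`, then `g` extends to a semilinear map
`B → C`. -/
theorem exists_semilinear_extension (hinj : Function.Injective f) {σ : ProjMap A}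
    (hσ : σ.Resolves (coker f)) {C : Type w} [Ring C] {g : A →+* C}
    (hg : Function.Bijective (ExtScalars.map g σ.hom)) :
    ∃ φ : asModule f →ₛₗ[g] C, ∀ a, φ (asLinearMap f a) = g a := by
  obtain ⟨q, α, hq, hi, he, hs⟩ := exists_resolution_of_coker hinj hσ
  let γ : A →ₛₗ[g] C := { toFun := g, map_add' := g.map_add, map_smul' := g.map_mul }
  let s := LinearEquiv.ofBijective (ExtScalars.map g σ.hom) hg
  -- Inverting C ⊗ σ extends g α from P to Q. Then (x, a) ↦ θ(1 ⊗ x) - g a vanishes on the image of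
  -- P and descends to B.
  let θ : ExtScalars g σ.Q →ₗ[C] C :=
    ExtScalars.lift γ ∘ₗ ExtScalars.map g α ∘ₗ s.symm.toLinearMap
  have hθ : ∀ y, θ (ExtScalars.tmul g 1 (σ.hom y)) = g (α y) := fun y => by
    have : s.symm (ExtScalars.tmul g 1 (σ.hom y)) = ExtScalars.tmul g 1 y := by
      rw [LinearEquiv.symm_apply_eq]; rfl
    change ExtScalars.lift γ (ExtScalars.map g α (s.symm _)) = _
    rw [this, ExtScalars.map_tmul, ExtScalars.lift_tmul, one_smul]
    rfl
  let ψ : (σ.Q × A) →ₛₗ[g] C :=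
    { toFun := fun x => θ (ExtScalars.tmul g 1 x.1) - g x.2
      map_add' := fun x y => by
        rw [Prod.fst_add, Prod.snd_add, ExtScalars.tmul_add, map_add, map_add]
        abel
      map_smul' := fun a x => by
        rw [Prod.smul_fst, Prod.smul_snd, ExtScalars.tmul_smul, one_mul, smul_eq_mul, map_mul,
          smul_sub, ← map_smul, ExtScalars.smul_tmul, mul_one, smul_eq_mul] }
  obtain ⟨φ, hφ⟩ := exists_semilinear_factor hs ψ fun x hx => by
    obtain ⟨y, rfl⟩ := (he x).1 hx
    exact sub_eq_zero.2 (hθ y)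
  refine ⟨φ, fun a => ?_⟩
  have h := hφ (0, -a)
  have h' : ψ (0, -a) = g a := by
    change θ (ExtScalars.tmul g 1 0) - g (-a) = g a
    rw [ExtScalars.tmul_zero, map_zero, map_neg, zero_sub, neg_neg]
  rw [← h', ← h]
  simp

/-- Right multiplication by an element of `B`, as an endomorphism of the left `A`-module `B`. -/
def rightMul (f : A →+* B) (b : B) : asModule f →ₗ[A] asModule f where
  toFun x := toAsModule f ((show B from x) * b)
  map_add' x y := add_mul (show B from x) (show B from y) b
  map_smul' a x := mul_assoc (f a) (show B from x) b

theorem rightMul_apply (b c : B) : rightMul f b (toAsModule f c) = toAsModule f (c * b) := rfl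

/-- As C ⊗ A → C ⊗ B is onto, 1 ⊗ b = φ(b) ⊗ 1 for the semilinear extension φ. Right multiplication
by c turns this into 1 ⊗ bc = φ(b) ⊗ c, and applying φ gives multiplicativity. -/
theorem exists_ringHom_extension (hinj : Function.Injective f) {σ : ProjMap A}
    (hσ : σ.Resolves (coker f)) {C : Type w} [Ring C] {g : A →+* C}
    (hg : Function.Bijective (ExtScalars.map g σ.hom)) :
    ∃ h : B →+* C, g = h.comp f := by
  obtain ⟨φ, hφ⟩ := exists_semilinear_extension hinj hσ hg
  have hφ1 : φ (toAsModule f 1) = 1 := by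
    rw [← map_one f, ← asLinearMap_apply, hφ, map_one]
  have hA : ∀ z : ExtScalars g A, ∃ c, z = ExtScalars.tmul g c 1 := by
    intro z
    induction z using ExtScalars.induction with
    | zero => exact ⟨0, (ExtScalars.zero_tmul _).symm⟩
    | tmul c a => exact ⟨c * g a, by rw [← ExtScalars.tmul_smul, smul_eq_mul, mul_one]⟩
    | add x y hx hy =>
      obtain ⟨c, rfl⟩ := hx
      obtain ⟨d, rfl⟩ := hy
      exact ⟨c + d, (ExtScalars.add_tmul _ _ _).symm⟩
  have key : ∀ b : B, ExtScalars.tmul g 1 (toAsModule f b) =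
      ExtScalars.tmul g (φ (toAsModule f b)) (toAsModule f 1) := by
    intro b
    obtain ⟨z, hz⟩ := (map_resolution_coker_surjective_iff g hσ).1 hg.2
      (ExtScalars.tmul g 1 (toAsModule f b))
    obtain ⟨c, rfl⟩ := hA z
    rw [ExtScalars.map_tmul, asLinearMap_apply, map_one] at hz
    have := congrArg (ExtScalars.lift φ) hz
    rw [ExtScalars.lift_tmul, ExtScalars.lift_tmul, hφ1, smul_eq_mul, mul_one, one_smul] at this
    rw [← hz, this]
  refine ⟨{ toFun := fun b => φ (toAsModule f b)
            map_one' := hφ1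
            map_mul' := fun b c => ?_
            map_zero' := by rw [map_zero, map_zero]
            map_add' := fun b c => by rw [map_add, map_add] }, RingHom.ext fun a => (hφ a).symm⟩
  have := congrArg (fun z => ExtScalars.lift φ (ExtScalars.map g (rightMul f c) z)) (key b)
  simpa only [ExtScalars.map_tmul, ExtScalars.lift_tmul, rightMul_apply, one_mul, one_smul,
    smul_eq_mul] using this

theorem isUniversalLocalisation_coker (hf : IsRingEpi f)
    (hTor : Limits.IsZero (Tor f 1 (asModule f))) (hinj : Function.Injective f) {σ : ProjMap A}
    (hσ : σ.Resolves (coker f)) : IsUniversalLocalisation.{u, w} f {σ} := by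
  refine ⟨?_, fun C _ g hg => ?_⟩
  · rintro _ rfl
    exact inverts_resolution_coker hf hTor hinj hσ
  · obtain ⟨h, rfl⟩ := exists_ringHom_extension hinj hσ (hg σ rfl)
    exact ⟨h, rfl, fun h' H => hf.ringHom_ext H.symm⟩

end Injective

/-! ### Surjective epimorphisms: localisation at the kernel -/

section Surjective

theorem exact_subtype_ker_asLinearMap :
    Function.Exact (Submodule.subtype (RingHom.ker f)) (asLinearMap f) := fun a =>
  ⟨fun ha => ⟨⟨a, ha⟩, rfl⟩, by rintro ⟨x, rfl⟩; exact x.2⟩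

theorem finite_projective_ker (hB : IsFPOfProjDimLEOne (asModule f))
    (hsurj : Function.Surjective f) : Module.Finite A (ker f) ∧ Module.Projective A (ker f) := by
  obtain ⟨hfp, hpd⟩ := hB
  exact ⟨Module.Finite.iff_fg.2 (Module.FinitePresentation.fg_ker (asLinearMap f) hsurj),
    projective_of_shortExact hpd (Submodule.injective_subtype (RingHom.ker f))
      exact_subtype_ker_asLinearMap hsurj⟩

/-- The map B ⊗ ker f → B ⊗ A is injective by Tor₁ and zero because c ⊗ x = c f(x) ⊗ 1. -/
theorem subsingleton_extScalars_ker (hTor : Limits.IsZero (Tor f 1 (asModule f)))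
    (hsurj : Function.Surjective f) (hproj : Module.Projective A (ker f)) :
    Subsingleton (ExtScalars f (ker f)) := by
  have hi := map_injective_of_isZero_tor hTor (P := ker f) (Q := A)
    (Submodule.injective_subtype (RingHom.ker f)) exact_subtype_ker_asLinearMap hsurj
  refine subsingleton_of_forall_eq 0 fun z => hi ?_
  rw [map_zero]
  induction z using ExtScalars.induction with
  | zero => exact map_zero _
  | tmul c x =>
    have hx : f x.1 = 0 := x.2
    rw [ExtScalars.map_tmul, Submodule.subtype_apply, ← mul_one x.1, ← smul_eq_mul,
      ExtScalars.tmul_smul, hx, mul_zero, ExtScalars.zero_tmul]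
  | add x y hx hy => rw [map_add, hx, hy, add_zero]

theorem isUniversalLocalisation_ker (hTor : Limits.IsZero (Tor f 1 (asModule f)))
    (hsurj : Function.Surjective f) (hproj : Module.Projective A (ker f)) {σ : ProjMap A}
    (hσ : σ.Resolves (ker f)) : IsUniversalLocalisation.{u, w} f {σ} := by
  obtain ⟨hi, p, he, hp⟩ := hσ
  refine ⟨?_, fun C _ g hg => ?_⟩
  · intro τ hτ
    rw [Set.mem_singleton_iff.1 hτ]
    refine ⟨?_, (ExtScalars.map_surjective_iff_subsingleton f he hp).2
      (subsingleton_extScalars_ker hTor hsurj hproj)⟩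
    -- Projectivity of the kernel splits the resolution, so σ has a retraction, which survives B ⊗
    -- -.
    obtain ⟨s, hs⟩ := Module.projective_lifting_property p LinearMap.id hp
    have hsplit : (∃ l, p ∘ₗ l = LinearMap.id) ↔ ∃ l, l ∘ₗ σ.hom = LinearMap.id :=
      (he.split_tfae hi hp).out 0 1
    obtain ⟨r, hr⟩ := hsplit.1 ⟨s, hs⟩
    exact Function.LeftInverse.injective (g := ExtScalars.map f r) fun z => by
      rw [ExtScalars.map_comp_apply, hr, ExtScalars.map_id_apply]
  · have := (ExtScalars.map_surjective_iff_subsingleton g he hp).1 (hg σ rfl).2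
    let γ : ker f →ₛₗ[g] C :=
      { toFun := fun x => g x.1
        map_add' := fun x y => g.map_add x.1 y.1
        map_smul' := fun a x => g.map_mul a x.1 }
    -- The restriction of g to ker f extends to C ⊗ ker f = 0, hence is zero.
    have hker : RingHom.ker f ≤ RingHom.ker g := fun x hx => by
      have h := congrArg (ExtScalars.lift γ)
        (Subsingleton.elim (ExtScalars.tmul g 1 (⟨x, hx⟩ : ker f)) 0)
      rw [ExtScalars.lift_tmul, map_zero, one_smul] at h
      exact h
    refine ⟨f.liftOfSurjective hsurj ⟨g, hker⟩,
      (RingHom.liftOfRightInverse_comp f _ _ ⟨g, hker⟩).symm, fun h' H => ?_⟩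
    refine RingHom.ext fun b => ?_
    obtain ⟨a, rfl⟩ := hsurj b
    rw [← RingHom.comp_apply, ← H]
    exact (RingHom.liftOfRightInverse_comp_apply f _ _ ⟨g, hker⟩ a).symm

/-- The kernel of a surjective homological epimorphism is idempotent as soon as it is projective. -/
theorem ker_le_mul_self (hTor : Limits.IsZero (Tor f 1 (asModule f)))
    (hsurj : Function.Surjective f) (hproj : Module.Projective A (ker f)) :
    RingHom.ker f ≤ RingHom.ker f * RingHom.ker f := by
  intro x hx
  have := subsingleton_extScalars_ker hTor hsurj hproj
  obtain ⟨s, hs⟩ := hproj.out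
  -- Each dual-basis coordinate, followed by f, extends to B ⊗ ker f = 0. So the coordinates lie in
  -- the kernel, and x = ∑ s(x)ᵢ i lies in its square.
  have hmem : ∀ (y i : ker f), s y i ∈ RingHom.ker f := by
    intro y i
    let γ : ker f →ₛₗ[f] B :=
      { toFun := fun z => f (s z i)
        map_add' := fun z t => by simp
        map_smul' := fun a z => by simp }
    have h := congrArg (ExtScalars.lift γ) (Subsingleton.elim (ExtScalars.tmul f 1 y) 0)
    rw [ExtScalars.lift_tmul, map_zero, one_smul] at h
    exact h
  have hx' := congrArg Subtype.val (hs ⟨x, hx⟩)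
  rw [Finsupp.linearCombination_apply, Finsupp.sum] at hx'
  rw [← show _ = x from hx']
  rw [← Submodule.subtype_apply, map_sum]
  exact Submodule.sum_mem _ fun i _ => Ideal.mul_mem_mul (hmem _ i) i.2

end Surjective

end RingEpi

end

/-! ### Idempotent ideals in finite dimensional algebras -/

section IdempotentIdeals

/-- In a finite dimensional algebra, some positive power of each element `y` generates the same
right ideal as an idempotent that is a multiple of that power. -/
theorem exists_isIdempotentElem_pow_mul (K : Type v) {A : Type u} [Field K] [Ring A] [Algebra K A]
    [FiniteDimensional K A] (y : A) :
    ∃ (n : ℕ) (z : A), Commute y z ∧ IsIdempotentElem (y ^ (n + 1) * z) ∧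
      y ^ (n + 1) * z * y ^ (n + 1) = y ^ (n + 1) := by
  -- The subalgebra K[y] is commutative and artinian, so the powers of y stabilise up to a factor t.
  let R := Algebra.adjoin K ({y} : Set A)
  have : IsMulCommutative R := Algebra.isMulCommutative_adjoin K (by rintro _ rfl _ rfl; rfl)
  have : IsArtinianRing R := isArtinian_of_tower K inferInstance
  let x : R := ⟨y, Algebra.self_mem_adjoin_singleton K y⟩
  obtain ⟨n, t, ht⟩ := IsArtinian.exists_pow_succ_smul_dvd x (1 : R)
  rw [smul_eq_mul, smul_eq_mul, mul_one] at ht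
  have hk : ∀ k, x ^ (n + k) * t ^ k = x ^ n := by
    intro k
    induction k with
    | zero => simp
    | succ k ih =>
      calc x ^ (n + (k + 1)) * t ^ (k + 1) = x ^ k * t ^ k * (x ^ (n + 1) * t) := by ring
        _ = x ^ (n + k) * t ^ k := by rw [ht]; ring
        _ = x ^ n := ih
  -- The exponent n + 1 keeps the power positive, so the idempotent lies in any two-sided ideal
  -- containing y.
  have hx : x ^ (n + 1) * t ^ (n + 1) * x ^ (n + 1) = x ^ (n + 1) := by
    calc x ^ (n + 1) * t ^ (n + 1) * x ^ (n + 1) = x ^ (n + (n + 1)) * t ^ (n + 1) * x := by ring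
      _ = x ^ (n + 1) := by rw [hk, pow_succ]
  have hi : x ^ (n + 1) * t ^ (n + 1) * (x ^ (n + 1) * t ^ (n + 1)) =
      x ^ (n + 1) * t ^ (n + 1) := by rw [← mul_assoc, hx]
  exact ⟨n, (t : A) ^ (n + 1), congrArg Subtype.val (mul_comm x (t ^ (n + 1))),
    congrArg Subtype.val hi, congrArg Subtype.val hx⟩

/-- An ideal `I` of a left noetherian ring contains an idempotent `e` such that `0` is the only
idempotent of `I` orthogonal to `e`. -/
theorem Ideal.exists_maximal_isIdempotentElem {A : Type u} [Ring A] [IsNoetherianRing A]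
    (I : Ideal A) :
    ∃ e ∈ I, IsIdempotentElem e ∧
      ∀ d ∈ I, IsIdempotentElem d → e * d = 0 → d * e = 0 → d = 0 := by
  -- Choose e with Ae maximal. For orthogonal d, Ae ⊆ A(e + d) is then an equality, so d ∈ Ae and d
  -- = de = 0.
  obtain ⟨_, ⟨e, he, hid, rfl⟩, hmax⟩ := WellFounded.has_min
    (wellFounded_gt (α := Ideal A)) {J | ∃ e ∈ I, IsIdempotentElem e ∧ J = Ideal.span {e}}
    ⟨_, 0, I.zero_mem, IsIdempotentElem.zero, rfl⟩
  refine ⟨e, he, hid, fun d hd hdd hed hde => ?_⟩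
  have hsum : IsIdempotentElem (e + d) := by
    rw [IsIdempotentElem, mul_add, add_mul, add_mul, hid.eq, hdd.eq, hed, hde, add_zero, zero_add]
  have hle : Ideal.span {e} ≤ Ideal.span {e + d} := by
    rw [Ideal.span_singleton_le_iff_mem, Ideal.mem_span_singleton']
    exact ⟨e, by rw [mul_add, hid.eq, hed, add_zero]⟩
  have heq : Ideal.span {e} = Ideal.span {e + d} :=
    eq_of_le_of_not_lt hle (hmax _ ⟨e + d, I.add_mem he hd, hsum, rfl⟩)
  have hmem : d ∈ Ideal.span {e} := by
    rw [heq, Ideal.mem_span_singleton']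
    exact ⟨d, by rw [mul_add, hde, hdd.eq, zero_add]⟩
  obtain ⟨a, rfl⟩ := Ideal.mem_span_singleton'.1 hmem
  rw [← hde, mul_assoc, hid.eq]

/-- An idempotent two-sided ideal of a finite dimensional algebra is generated by an idempotent. -/
theorem Ideal.exists_isIdempotentElem_mem_iff_mem_span (K : Type v) {A : Type u} [Field K] [Ring A]
    [Algebra K A] [FiniteDimensional K A] (I : Ideal A) [I.IsTwoSided] (hI : I ≤ I * I) :
    ∃ e : A, IsIdempotentElem e ∧ ∀ x, x ∈ I ↔ x ∈ TwoSidedIdeal.span {e} := by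
  have : IsNoetherianRing A := isNoetherian_of_tower K inferInstance
  obtain ⟨e, he, hid, hmax⟩ := I.exists_maximal_isIdempotentElem
  refine ⟨e, hid, ?_⟩
  let J : Ideal A := TwoSidedIdeal.asIdeal (TwoSidedIdeal.span {e})
  have hJ : ∀ x, x ∈ J ↔ x ∈ TwoSidedIdeal.span {e} := fun x => TwoSidedIdeal.mem_asIdeal
  have heJ : e ∈ J := (hJ e).2 (TwoSidedIdeal.subset_span rfl)
  have hJr : ∀ x ∈ J, ∀ a, x * a ∈ J := fun x hx a =>
    (hJ _).2 (TwoSidedIdeal.mul_mem_right _ _ _ ((hJ x).1 hx))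
  have hJI : J ≤ I := fun x hx => by
    have : TwoSidedIdeal.span {e} ≤ I.toTwoSided := by
      rw [TwoSidedIdeal.span_le]
      rintro _ rfl
      exact Ideal.mem_toTwoSided.2 he
    exact Ideal.mem_toTwoSided.1 (this ((hJ x).1 hx))
  have hnil : ∀ y ∈ I, e * y = 0 → y * e = 0 → IsNilpotent y := by
    intro y hy hey hye
    obtain ⟨n, z, hyz, hd, hpow⟩ := exists_isIdempotentElem_pow_mul K y
    have hz : y ^ (n + 1) * z = 0 := by
      refine hmax _ (I.mul_mem_right _ (I.pow_mem_of_mem hy _ n.succ_pos)) hd ?_ ?_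
      · rw [pow_succ', ← mul_assoc, ← mul_assoc, hey, zero_mul, zero_mul]
      · rw [(hyz.pow_left _).eq, pow_succ, mul_assoc, mul_assoc, hye, mul_zero, mul_zero]
    exact ⟨n + 1, by rw [← hpow, hz, zero_mul]⟩
  suffices h : J = I by
    intro x
    rw [← h, hJ]
  by_contra hne
  -- I/N is a simple left module. The aim is I · I ⊆ N, which contradicts I ⊆ I · I.
  obtain ⟨N, hJN, hN⟩ := exists_le_covBy_of_lt (lt_of_le_of_ne hJI hne)
  have hIN : ¬ I ≤ N := fun h => hN.lt.not_ge h
  apply hIN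
  refine hI.trans (Ideal.mul_le.2 fun x hx s hs => ?_)
  by_contra hxs
  have hsup : N ⊔ Ideal.span {x * s} = I := by
    refine (hN.eq_or_eq le_sup_left (sup_le hN.le ?_)).resolve_left fun h => hxs ?_
    · rw [Ideal.span_singleton_le_iff_mem]
      exact I.mul_mem_left _ hs
    · rw [← h]
      exact Ideal.mem_sup_right (Ideal.mem_span_singleton_self _)
  obtain ⟨m, hm, _, ht, hmt⟩ := Submodule.mem_sup.1 (hsup.symm ▸ hs)
  obtain ⟨a, rfl⟩ := Ideal.mem_span_singleton'.1 ht
  have hax : a * x ∈ I := I.mul_mem_left _ hx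
  -- Simplicity gives s ≡ axs modulo N. Cutting ax down by 1 - e changes it only within AeA, so s ≡
  -- ys, hence s ≡ yᵏs, and y is nilpotent.
  obtain ⟨y, hy⟩ : ∃ y, y = (1 - e) * (a * x) * (1 - e) := ⟨_, rfl⟩
  have hdiff : a * x - y ∈ J := by
    have : a * x - y = e * (a * x) * (1 - e) + a * x * e := by rw [hy]; noncomm_ring
    rw [this]
    exact J.add_mem (hJr _ (hJr _ heJ _) _) (J.mul_mem_left _ heJ)
  have hys : s - y * s ∈ N := by
    have : s - y * s = m + (a * x - y) * s := by
      rw [sub_mul, mul_assoc a x s, ← add_sub_assoc, hmt]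
    rw [this]
    exact N.add_mem hm (hJN (hJr _ hdiff _))
  have hpow : ∀ k : ℕ, s - y ^ k * s ∈ N := by
    intro k
    induction k with
    | zero => simp
    | succ k ih =>
      have : s - y ^ (k + 1) * s = (s - y ^ k * s) + y ^ k * (s - y * s) := by
        rw [pow_succ]; noncomm_ring
      rw [this]
      exact N.add_mem ih (N.mul_mem_left _ hys)
  have hyI : y ∈ I := hy ▸ I.mul_mem_right _ (I.mul_mem_left _ hax)
  obtain ⟨k, hk⟩ := hnil y hyI
    (by rw [hy, ← mul_assoc, ← mul_assoc, hid.mul_one_sub_self, zero_mul, zero_mul])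
    (by rw [hy, mul_assoc, hid.one_sub_mul_self, mul_zero])
  have hsN : s ∈ N := by simpa [hk] using hpow k
  exact hxs (N.mul_mem_left _ hsN)

end IdempotentIdeals

/-! ### Epiclasses of surjections and the main theorem -/

namespace RingEpi

theorem modIdeal_eq_zero_iff {A : Type u} [Ring A] (e x : A) :
    modIdeal e x = 0 ↔ x ∈ TwoSidedIdeal.span {e} := by
  rw [← TwoSidedIdeal.mem_ker, modIdeal, TwoSidedIdeal.ker_ringCon_mk']

theorem SameEpiclass.of_surjective {A B C : Type u} [Ring A] [Ring B] [Ring C] {f : A →+* B}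
    {g : A →+* C} (hf : Function.Surjective f) (hg : Function.Surjective g)
    (h : ∀ x, f x = 0 ↔ g x = 0) : SameEpiclass f g := by
  refine ⟨isRingEpi_of_surjective hf, isRingEpi_of_surjective hg, ?_⟩
  let k := f.liftOfSurjective hf ⟨g, fun x hx => (h x).1 hx⟩
  have hk : ∀ x, k (f x) = g x := fun x => RingHom.liftOfRightInverse_comp_apply f _ _ ⟨g, _⟩ x
  refine ⟨RingEquiv.ofBijective k ⟨(injective_iff_map_eq_zero k).2 fun b hb => ?_, fun c => ?_⟩,
    RingHom.ext fun x => (hk x).symm⟩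
  · obtain ⟨a, rfl⟩ := hf b
    rw [hk] at hb
    exact (h a).2 hb
  · obtain ⟨a, rfl⟩ := hg c
    exact ⟨f a, hk a⟩

end RingEpi

theorem corollary3p5 {A B : Type u} [Ring A] [Ring B] (f : A →+* B)
    (hf : RingEpi.IsHomological f) (hfin : RingEpi.IsOneFinite f) :
    (Function.Injective f →
      RingEpi.IsFPOfProjDimLEOne (RingEpi.coker f) ∧
      RingEpi.SameEpiclassAsLocalisationAt.{u, w} f {RingEpi.coker f}) ∧
    (Function.Surjective f →
      (Module.FinitePresentation A (RingEpi.ker f) ∧ Module.Projective A (RingEpi.ker f)) ∧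
      RingEpi.SameEpiclassAsLocalisationAt.{u, w} f {RingEpi.ker f}) ∧
    (∀ (K : Type v) [Field K] [Algebra K A] [FiniteDimensional K A],
      Function.Surjective f →
      ∃ e : A, IsIdempotentElem e ∧ RingEpi.SameEpiclass f (RingEpi.modIdeal e)) := by
  obtain ⟨hepi, hTor⟩ := hf
  have hTor₁ := hTor 1 one_pos
  refine ⟨fun hinj => ?_, fun hsurj => ?_, fun K _ _ _ hsurj => ?_⟩
  · have hU := RingEpi.isFPOfProjDimLEOne_coker hfin.2 hinj
    exact ⟨hU, .of_isUniversalLocalisation hepi hU fun σ hσ =>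
      RingEpi.isUniversalLocalisation_coker hepi hTor₁ hinj hσ⟩
  · obtain ⟨_, hproj⟩ := RingEpi.finite_projective_ker hfin.2 hsurj
    have hU := RingEpi.isFPOfProjDimLEOne_of_projective (RingEpi.ker f)
    exact ⟨⟨hU.1, hproj⟩, .of_isUniversalLocalisation hepi hU fun σ hσ =>
      RingEpi.isUniversalLocalisation_ker hTor₁ hsurj hproj hσ⟩
  · obtain ⟨_, hproj⟩ := RingEpi.finite_projective_ker hfin.2 hsurj
    obtain ⟨e, he, hmem⟩ := Ideal.exists_isIdempotentElem_mem_iff_mem_span K (RingHom.ker f)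
      (RingEpi.ker_le_mul_self hTor₁ hsurj hproj)
    refine ⟨e, he, .of_surjective hsurj (RingCon.mk'_surjective _) fun x => ?_⟩
    rw [RingEpi.modIdeal_eq_zero_iff, ← hmem, RingHom.mem_ker]
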